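/- **Theorem 3.1.** Let $\mathcal M$ be a von Neumann algebra on a complex Hilbert space, with identity $I$ and center $\mathcal Z(\mathcal M)$, without central summands of type $I_1$ (that is, there is no nonzero central projection $C\in\mathcal M$ for which $C\mathcal M C$ is commutative). Let $\xi\in\mathbb C$ with $\xi\neq 1$, write $[A,B]_\xi=AB-\xi BA$, and let $L:\mathcal M\to\mathcal M$ be an additive map. An additive map $\varphi:\mathcal M\to\mathcal M$ is called an additive derivation if $\varphi(AB)=\varphi(A)B+A\varphi(B)$ for all $A,B\in\mathcal M$. Then $$L([A,B]_\xi)=[L(A),B]_\xi+[A,L(B)]_\xi\quad\text{for all }A,B\in\mathcal M\text{ with }AB=0$$ if and only if $L(I)\in\mathcal Z(\mathcal M)$ and one of the following holds: 1. $\xi\neq 0,-1$, and there is an additive derivation $\varphi$ of $\mathcal M$ with $\varphi(\xi I)=\xi L(I)$ and $L(A)=\varphi(A)+L(I)A$ for all $A\in\mathcal M$; 2. $\xi=0$, and there is an additive derivation $\varphi$ of $\mathcal M$ with $L(A)=\varphi(A)+L(I)A$ for all $A\in\mathcal M$; 3. $\xi=-1$, and $L$ is an additive Jordan derivation, i.e.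 $L(A^2)=L(A)A+AL(A)$ for all $A\in\mathcal M$. Moreover, if $L$ satisfies the displayed condition, $\xi\neq 0,-1$, and both the real and the imaginary part of $\xi$ are rational, then $L$ is an additive derivation. -/

import Mathlib

/-- A von Neumann algebra is closed under multiplication by complex scalars, so that its elements
form a complex algebra. -/
instance VonNeumannAlgebra.instSMulMemClass {H : Type*} [NormedAddCommGroup H]
    [InnerProductSpace ℂ H] [CompleteSpace H] :
    SMulMemClass (VonNeumannAlgebra H) ℂ (H →L[ℂ] H) where
  smul_mem {s} c _ hx := s.toStarSubalgebra.smul_mem hx c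

/-- `E` is an abelian projection of the star ring `R`: a self-adjoint idempotent for which the
corner `E R E` is commutative. -/
def IsAbelianProjection {R : Type*} [Ring R] [Star R] (E : R) : Prop :=
  IsStarProjection E ∧ ∀ A B : R, Commute (E * A * E) (E * B * E)

/-- The von Neumann algebra `M` has no central summand of type `I₁`: there is no nonzero central
projection `C` for which the summand `M C` is of type `I₁`, which means that its identity `C` is an
abelian projection. -/
def NoCentralSummandOfTypeIOne {H : Type*} [NormedAddCommGroup H] [InnerProductSpace ℂ H]
    [CompleteSpace H] (M : VonNeumannAlgebra H) : Prop :=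
  ∀ C : M, C ∈ Subring.center M → IsAbelianProjection C → C = 0

/-- The `ξ`-Lie product `[A, B]_ξ = AB - ξ BA`. -/
def xiLie {R : Type*} [Ring R] [Algebra ℂ R] (ξ : ℂ) (A B : R) : R :=
  A * B - ξ • (B * A)

/-- An additive derivation of a ring (no linearity over scalars is required). -/
def IsAdditiveDerivation {R : Type*} [Ring R] (D : R →+ R) : Prop :=
  ∀ A B : R, D (A * B) = D A * B + A * D B

/-- An additive Jordan derivation of a ring. -/
def IsAdditiveJordanDerivation {R : Type*} [Ring R] (D : R →+ R) : Prop :=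
  ∀ A : R, D (A ^ 2) = D A * A + A * D A

/-- `L` is `ξ`-Lie derivable at zero products. -/
def IsXiLieDerivableAtZeroProducts {R : Type*} [Ring R] [Algebra ℂ R] (ξ : ℂ) (L : R →+ R) : Prop :=
  ∀ A B : R, A * B = 0 → L (xiLie ξ A B) = xiLie ξ (L A) B + xiLie ξ A (L B)

/-- A complex number is rational if its real and imaginary parts are rational. -/
def IsRationalComplex (ξ : ℂ) : Prop :=
  (∃ p : ℚ, ξ.re = p) ∧ ∃ q : ℚ, ξ.im = q

/-! Idempotents carry all the information. The zero products p(1 - p) = 0 force `L 1` to commute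
with every idempotent. Once `L 1` is known to be central, D = L - L(1)· satisfies a twisted identity
at zero products, and its Peirce components give D(Xp) = D(X)p + X D(p) for every idempotent p
(`IsTwistedXiLieDerivable.map_mul_idempotent`).

The s with D(Xs) = D(X)s + X D(s) for all X form a subring. It contains the idempotents, hence the
left ideal generated by the elements pX(1 - p). Absence of type I₁ summands says that this ideal has
zero left annihilator (`NoCentralSummandOfTypeIOne.faithfulOffDiagonal`), which extends the Leibniz
rule to all products; the same argument turns commutation with idempotents into centrality.

Comparing the Leibniz rule with the twisted identity gives φ(ξI) = ξL(I). All ξ ≠ 1 are treated at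
once; if ξ = -1, or ξ ≠ 0 is rational, then φ(ξI) = 0, so L(I) = 0 and L = φ. -/

section PeirceDecomposition

/-! ### Peirce components of the identity at zero products. -/

variable {R : Type*} [Ring R] [Algebra ℂ R]

/-- The point where ξ ≠ 1 enters: Peirce compressions reduce to equations x = ξx. -/
theorem smul_sub_self_eq_zero {ξ : ℂ} (hξ : ξ ≠ 1) {x : R} (h : x = ξ • x) : x = 0 := by
  have h1 : (1 - ξ) • x = 0 := by rw [sub_smul, one_smul, ← h, sub_self]
  exact (smul_eq_zero.mp h1).resolve_left (sub_ne_zero.mpr hξ.symm)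

/-- The identity satisfied by `L - L(1)` when `L` is `ξ`-Lie derivable at zero products. -/
def IsTwistedXiLieDerivable (ξ : ℂ) (c : R) (D : R →+ R) : Prop :=
  ∀ A B : R, A * B = 0 → D (ξ • (B * A)) =
    -(D A * B) + ξ • (B * D A) - A * D B + ξ • (D B * A) + ξ • (c * (B * A))

/-- Compressing the identity for pq = 0 to the (p, q) corner leaves only pL(p)q + pL(q)q. -/
theorem peirce_map_one_eq_zero {ξ : ℂ} {L : R →+ R}
    (hL : IsXiLieDerivableAtZeroProducts ξ L) {p q : R} (hp : p * p = p) (hq : q * q = q)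
    (hpq : p * q = 0) (hqp : q * p = 0) (h1 : p + q = 1) : p * L 1 * q = 0 := by
  have h := congrArg (fun t => p * t * q) (hL p q hpq)
  have hp' : ∀ x, p * (p * x) = p * x := fun x => by rw [← mul_assoc, hp]
  have hpq' : ∀ x, p * (q * x) = 0 := fun x => by rw [← mul_assoc, hpq, zero_mul]
  simp only [xiLie, hpq, hqp, smul_zero, sub_zero, map_zero, mul_zero, zero_mul, mul_add, mul_sub,
    add_mul, sub_mul, mul_smul_comm, smul_mul_assoc, mul_assoc, hp', hpq', hq] at h
  rw [← h1, map_add, mul_add, add_mul, mul_assoc, mul_assoc]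
  exact h.symm

theorem commute_map_one_of_isIdempotentElem {ξ : ℂ} {L : R →+ R}
    (hL : IsXiLieDerivableAtZeroProducts ξ L) {p : R} (hp : p * p = p) : Commute (L 1) p := by
  have e1 := peirce_map_one_eq_zero hL (p := p) (q := 1 - p) hp (by noncomm_ring [hp])
    (by noncomm_ring [hp]) (by noncomm_ring [hp]) (by abel)
  have e2 := peirce_map_one_eq_zero hL (p := 1 - p) (q := p) (by noncomm_ring [hp]) hp
    (by noncomm_ring [hp]) (by noncomm_ring [hp]) (by abel)
  rw [mul_sub, mul_one, sub_eq_zero] at e1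
  rw [sub_mul, sub_mul, one_mul, sub_eq_zero] at e2
  exact e2.trans e1.symm

variable {ξ : ℂ} {c : R} {D : R →+ R}

theorem IsTwistedXiLieDerivable.corner_idempotent (hξ : ξ ≠ 1)
    (hD : IsTwistedXiLieDerivable ξ c D) (hD1 : D 1 = 0) {p q : R} (hp : p * p = p)
    (hpq : p * q = 0) (hqp : q * p = 0) (h1 : p + q = 1) : p * (D p * p) = 0 := by
  have hDq : D q = -D p := by
    rw [eq_neg_iff_add_eq_zero, add_comm, ← map_add, h1, hD1]
  have h := congrArg (fun t => p * t * p) (hD p q hpq)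
  have hp' : ∀ x, p * (p * x) = p * x := fun x => by rw [← mul_assoc, hp]
  have hpq' : ∀ x, p * (q * x) = 0 := fun x => by rw [← mul_assoc, hpq, zero_mul]
  simp only [hDq, hqp, smul_zero, map_zero, mul_zero, zero_mul, mul_add, add_mul,
    mul_smul_comm, smul_mul_assoc, mul_assoc, hp', hpq', hp, mul_neg, neg_mul,
    neg_zero, zero_add, add_zero, smul_neg, sub_neg_eq_add] at h
  exact smul_sub_self_eq_zero hξ (add_neg_eq_zero.mp h.symm)

theorem IsTwistedXiLieDerivable.map_corner_mul (hξ : ξ ≠ 1)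
    (hD : IsTwistedXiLieDerivable ξ c D) (hD1 : D 1 = 0) {p q : R} (hp : p * p = p)
    (hq : q * q = q) (hpq : p * q = 0) (hqp : q * p = 0) (h1 : p + q = 1) {a : R}
    (hpa : p * a = a) (hap : a * p = a) : D a * q = a * D p := by
  have hDq : D q = -D p := by
    rw [eq_neg_iff_add_eq_zero, add_comm, ← map_add, h1, hD1]
  have hc := hD.corner_idempotent hξ hD1 hp hpq hqp h1
  have haq : a * q = 0 := by rw [← hap, mul_assoc, hpq, mul_zero]
  have hqa : q * a = 0 := by rw [← hpa, ← mul_assoc, hqp, zero_mul]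
  have hq' : ∀ x, q * (q * x) = q * x := fun x => by rw [← mul_assoc, hq]
  have hqa' : ∀ x, q * (a * x) = 0 := fun x => by rw [← mul_assoc, hqa, zero_mul]
  have h := congrArg (fun t => t * q) (hD a q haq)
  simp only [hDq, hqa, haq, smul_zero, map_zero, mul_zero, zero_mul, add_mul,
    smul_mul_assoc, mul_assoc, hq, mul_neg, neg_mul,
    neg_zero, add_zero, smul_neg, sub_neg_eq_add] at h
  have h' := congrArg (fun t => q * t) h
  simp only [mul_zero, mul_add, mul_smul_comm, mul_neg, hqa', hq', add_zero] at h'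
  -- The corner qD(a)q equals ξ times itself, so it vanishes and removes the ξ-term from `h`.
  have h2 := smul_sub_self_eq_zero hξ (neg_add_eq_zero.mp h'.symm)
  rw [h2, smul_zero, add_zero, eq_comm, neg_add_eq_zero] at h
  have h3 : a * (D p * p) = 0 := by rw [← hap, mul_assoc, hc, mul_zero]
  calc D a * q = a * (D p * q) + a * (D p * p) := by rw [h, h3, add_zero]
    _ = a * (D p * (p + q)) := by noncomm_ring
    _ = a * D p := by rw [h1, mul_one]

/-- The diagonal Peirce components of `D b` for an off-diagonal element `b`. -/
theorem IsTwistedXiLieDerivable.diagonal_of_offDiagonal (hξ : ξ ≠ 1)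
    (hD : IsTwistedXiLieDerivable ξ c D) (hD1 : D 1 = 0) {p q : R} (hp : p * p = p)
    (hq : q * q = q) (hpq : p * q = 0) (hqp : q * p = 0) (h1 : p + q = 1) {b : R}
    (hqb : q * b = b) (hbp : b * p = b) :
    q * (D b * q) = b * D p ∧ p * (D b * p) = -(D p * b) := by
  have hDq : D q = -D p := by
    rw [eq_neg_iff_add_eq_zero, add_comm, ← map_add, h1, hD1]
  have hc := hD.corner_idempotent hξ hD1 hp hpq hqp h1
  have hcq := hD.corner_idempotent hξ hD1 hq hqp hpq (by rw [add_comm, h1])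
  rw [hDq] at hcq
  have hcq' : q * (D p * q) = 0 := by simpa using hcq
  have hbq : b * q = 0 := by rw [← hbp, mul_assoc, hpq, mul_zero]
  have hpb : p * b = 0 := by rw [← hqb, ← mul_assoc, hpq, zero_mul]
  have hp' : ∀ x, p * (p * x) = p * x := fun x => by rw [← mul_assoc, hp]
  have hq' : ∀ x, q * (q * x) = q * x := fun x => by rw [← mul_assoc, hq]
  have hpq' : ∀ x, p * (q * x) = 0 := fun x => by rw [← mul_assoc, hpq, zero_mul]
  have hqp' : ∀ x, q * (p * x) = 0 := fun x => by rw [← mul_assoc, hqp, zero_mul]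
  have hqb' : ∀ x, q * (b * x) = b * x := fun x => by rw [← mul_assoc, hqb]
  have hpb' : ∀ x, p * (b * x) = 0 := fun x => by rw [← mul_assoc, hpb, zero_mul]
  have hbDp : b * (D p * q) = b * D p := by
    have h3 : b * (D p * p) = 0 := by rw [← hbp, mul_assoc, hc, mul_zero]
    calc b * (D p * q) = b * (D p * q) + b * (D p * p) := by rw [h3, add_zero]
      _ = b * (D p * (p + q)) := by noncomm_ring
      _ = b * D p := by rw [h1, mul_one]
  have hDpb : p * (D p * b) = D p * b := by
    have h3 : q * (D p * b) = 0 := by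
      rw [← hqb, ← mul_assoc (D p), ← mul_assoc q, hcq', zero_mul]
    calc p * (D p * b) = p * (D p * b) + q * (D p * b) := by rw [h3, add_zero]
      _ = (p + q) * (D p * b) := by noncomm_ring
      _ = D p * b := by rw [h1, one_mul]
  -- Both bq = 0 and pb = 0 evaluate D(ξb), with the same term ξcb; equating them removes both.
  have k1 := hD b q hbq
  have k2 := hD p b hpb
  rw [hqb] at k1
  rw [hbp] at k2
  have k := k1.symm.trans k2
  have kq := congrArg (fun t => q * t * q) k
  have kp := congrArg (fun t => p * t * p) k
  have hqDpb : q * (D p * b) = 0 := by rw [← hDpb, hqp']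
  simp only [hDq, smul_zero, sub_zero, mul_zero, mul_add, mul_sub, hqDpb, hDpb, hbDp,
    hpb', hqb', add_mul, sub_mul, mul_smul_comm, smul_mul_assoc, mul_assoc, hp, hq, mul_neg, neg_mul, hp', hq',
    hpq', hqp', hqp, hpq, hbq, hbp,
    neg_zero, zero_add, add_zero, smul_neg, sub_neg_eq_add] at kq kp
  constructor
  · rw [← sub_eq_zero]
    refine smul_sub_self_eq_zero hξ ?_
    rw [smul_sub]
    linear_combination (norm := module) -kq
  · rw [← sub_eq_zero]
    refine smul_sub_self_eq_zero hξ ?_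
    rw [smul_sub]
    linear_combination (norm := module) kp

end PeirceDecomposition

/-! ### From idempotents to all elements. -/

section LeibnizRule

variable {R : Type*} [Ring R] {D : R →+ R}

/-- No nonzero element of `R` annihilates all the products `Y p X (1 - p)` with `p` idempotent. -/
def FaithfulOffDiagonal (R : Type*) [Ring R] : Prop :=
  ∀ A : R, (∀ p X Y : R, p * p = p → A * (Y * (p * X * (1 - p))) = 0) → A = 0

/-- A subring containing all idempotents contains the left ideal generated by the off-diagonal
elements `p X (1 - p)`. -/
theorem Subring.mul_offDiagonal_mem (S : Subring R) (hS : ∀ p : R, p * p = p → p ∈ S) {p : R}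
    (hp : p * p = p) (X Y : R) : Y * (p * X * (1 - p)) ∈ S := by
  have hp' : ∀ x, p * (p * x) = p * x := fun x => by rw [← mul_assoc, hp]
  have h1 : ∀ X, p * X * (1 - p) ∈ S := fun X => by
    -- An off-diagonal element is a difference of two idempotents.
    have : (p + p * X * (1 - p)) * (p + p * X * (1 - p)) = p + p * X * (1 - p) := by
      simp only [mul_add, add_mul, mul_sub, sub_mul, mul_one, mul_assoc, hp, hp']
      abel
    simpa using S.sub_mem (hS _ this) (hS p hp)
  have h2 : (1 - p) * Y * p ∈ S := by
    have : (p + (1 - p) * Y * p) * (p + (1 - p) * Y * p) = p + (1 - p) * Y * p := by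
      simp only [mul_add, add_mul, mul_sub, sub_mul, one_mul, mul_assoc, hp, hp']
      abel
    simpa using S.sub_mem (hS _ this) (hS p hp)
  have h3 : Y * (p * X * (1 - p)) =
      p * (Y * p * X) * (1 - p) + ((1 - p) * Y * p) * (p * X * (1 - p)) := by
    simp only [mul_sub, sub_mul, mul_one, one_mul, mul_assoc, hp']
    abel
  rw [h3]
  exact S.add_mem (h1 _) (S.mul_mem h2 (h1 _))

/-- The subring of the elements at which `D` obeys the Leibniz rule with every left factor. -/
def rightLeibnizSubring (D : R →+ R) (hD1 : D 1 = 0) : Subring R where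
  carrier := {s | ∀ X, D (X * s) = D X * s + X * D s}
  one_mem' X := by simp [hD1]
  zero_mem' X := by simp
  add_mem' {a b} ha hb X := by
    simp only [mul_add, map_add, ha X, hb X]; abel
  neg_mem' {a} ha X := by
    simp only [mul_neg, map_neg, ha X]; abel
  mul_mem' {a b} ha hb X := by
    rw [← mul_assoc, hb, ha, hb a]; noncomm_ring

/-- For s in the left ideal, expanding D(ABs) as D((AB)s) and as D(A(Bs)) shows that the Leibniz
defect of (A, B) annihilates s. -/
theorem isAdditiveDerivation_of_map_mul_idempotent (hf : FaithfulOffDiagonal R) (hD1 : D 1 = 0)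
    (h : ∀ p X : R, p * p = p → D (X * p) = D X * p + X * D p) : IsAdditiveDerivation D := by
  have hS : ∀ p X Y Z : R, p * p = p → D (Z * (Y * (p * X * (1 - p)))) =
      D Z * (Y * (p * X * (1 - p))) + Z * D (Y * (p * X * (1 - p))) := fun p X Y Z hp =>
    (rightLeibnizSubring D hD1).mul_offDiagonal_mem (fun p hp X => h p X hp) hp X Y Z
  intro A B
  rw [← sub_eq_zero]
  refine hf _ fun p X Y hp => ?_
  have e1 := hS p X Y (A * B) hp
  have e2 := hS p X (B * Y) A hp
  have e3 := hS p X Y B hp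
  rw [mul_assoc B] at e2
  rw [e3, ← mul_assoc A, e1] at e2
  have e4 := sub_eq_zero.mpr e2
  rw [← e4]
  noncomm_ring

/-- The centralizer of z contains the left ideal, so z(As) = (As)z = A(zs) for s in it, and zA - Az
annihilates s. -/
theorem mem_center_of_commute_idempotents (hf : FaithfulOffDiagonal R) {z : R}
    (h : ∀ p : R, p * p = p → Commute z p) : z ∈ Subring.center R := by
  have hS : ∀ p X Y : R, p * p = p →
      z * (Y * (p * X * (1 - p))) = (Y * (p * X * (1 - p))) * z := fun p X Y hp =>
    (Subring.mem_centralizer_iff.mp <| (Subring.centralizer {z}).mul_offDiagonal_mem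
      (fun p hp => Subring.mem_centralizer_iff.mpr fun g hg => by
        rw [Set.mem_singleton_iff.mp hg]; exact h p hp) hp X Y) z rfl
  rw [Subring.mem_center_iff]
  intro A
  rw [← sub_eq_zero]
  refine hf _ fun p X Y hp => ?_
  have e2 := hS p X (A * Y) hp
  rw [mul_assoc A] at e2
  rw [sub_mul, mul_assoc, mul_assoc z, hS p X Y hp, e2, ← mul_assoc, sub_self]

theorem IsAdditiveDerivation.map_mem_center (hD : IsAdditiveDerivation D) {z : R}
    (hz : z ∈ Subring.center R) : D z ∈ Subring.center R := by
  rw [Subring.mem_center_iff] at hz ⊢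
  intro A
  have h := congrArg D (hz A)
  rw [hD, hD, hz, add_comm] at h
  exact add_right_cancel h

theorem IsAdditiveDerivation.map_one (hD : IsAdditiveDerivation D) : D 1 = 0 := by
  have h := hD 1 1
  simpa using h

end LeibnizRule

/-! ### The derivation attached to L, and the converse implications. -/

section DerivationFromIdempotents

variable {R : Type*} [Ring R] [Algebra ℂ R] {ξ : ℂ} {c : R} {D : R →+ R}

/-- Polarizing the identity at bb = 0 over the corner qRp gives b'yb' = 0 for y = pD(b)q and every
b' in that corner; semiprimeness then kills y. -/
theorem IsTwistedXiLieDerivable.offDiagonal_of_offDiagonal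
    (hsp : ∀ y : R, (∀ x, y * x * y = 0) → y = 0) (hξ : ξ ≠ 1)
    (hD : IsTwistedXiLieDerivable ξ c D) {p q : R} (hp : p * p = p)
    (hq : q * q = q) (hpq : p * q = 0) {b : R}
    (hqb : q * b = b) (hbp : b * p = b) : p * (D b * q) = 0 := by
  have hbb : ∀ b b', q * b' = b' → b * p = b → b * b' = 0 := fun b b' h h' => by
    rw [← h, ← h', mul_assoc, ← mul_assoc p, hpq, zero_mul, mul_zero]
  have hpb : ∀ b, q * b = b → p * b = 0 := fun b h => by rw [← h, ← mul_assoc, hpq, zero_mul]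
  have hbq : ∀ b, b * p = b → b * q = 0 := fun b h => by rw [← h, mul_assoc, hpq, mul_zero]
  have key : ∀ b, q * b = b → b * p = b → p * (D b * b) = 0 ∧ b * (D b * q) = 0 := by
    intro b h h'
    have k := hD b b (hbb b b h h')
    rw [hbb b b h h'] at k
    have k1 := congrArg (fun t => p * t) k
    have k2 := congrArg (fun t => t * q) k
    have hpb' : ∀ x, p * (b * x) = 0 := fun x => by rw [← mul_assoc, hpb b h, zero_mul]
    simp only [smul_zero, map_zero, mul_zero, zero_mul, mul_add, mul_sub, add_mul, sub_mul,
      mul_smul_comm, smul_mul_assoc, mul_assoc, mul_neg, neg_mul, hpb', hbq b h', neg_zero,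
      add_zero, zero_add, sub_zero] at k1 k2
    exact ⟨smul_sub_self_eq_zero hξ (neg_add_eq_zero.mp k1.symm),
      smul_sub_self_eq_zero hξ (sub_eq_zero.mp k2.symm).symm⟩
  have hq' : ∀ x, q * (q * x) = q * x := fun x => by rw [← mul_assoc, hq]
  have h0 : ∀ b', q * b' = b' → b' * p = b' → b' * (D b * b') = 0 := by
    intro b' h h'
    have k := (key (b + b') (by rw [mul_add, hqb, h]) (by rw [add_mul, hbp, h'])).1
    have k1 := (key b hqb hbp).1
    have k2 := (key b' h h').1
    have k3 := (key b' h h').2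
    have k4 : p * (D b * b') = -(p * (D b' * b)) := by
      simp only [map_add, mul_add, add_mul, k1, k2] at k
      rw [eq_neg_iff_add_eq_zero]
      simpa [add_comm] using k
    rw [← h', mul_assoc b' p, h', k4, mul_neg, ← mul_assoc b' p, h', ← hqb, ← mul_assoc (D b'),
      ← mul_assoc b', k3, zero_mul, neg_zero]
  set y := p * (D b * q) with hy
  have hyb : ∀ b', q * b' = b' → b' * p = b' → b' * y * b' = 0 := by
    intro b' h h'
    rw [hy, ← mul_assoc b', h', mul_assoc, mul_assoc, h, h0 b' h h']
  have hlin : ∀ u v, q * u = u → u * p = u → q * v = v → v * p = v →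
      u * y * v = -(v * y * u) := by
    intro u v hu hu' hv hv'
    have k := hyb (u + v) (by rw [mul_add, hu, hv]) (by rw [add_mul, hu', hv'])
    simp only [add_mul, mul_add, hyb u hu hu', hyb v hv hv'] at k
    rw [eq_neg_iff_add_eq_zero]
    simpa [add_comm] using k
  have hpy : p * y = y := by rw [hy, ← mul_assoc, hp]
  have hyq : y * q = y := by rw [hy, mul_assoc, mul_assoc, hq]
  have hcorner : ∀ x, y * (q * x * p) * y = y * x * y := fun x => by
    calc y * (q * x * p) * y = (y * q) * x * (p * y) := by simp only [mul_assoc]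
      _ = _ := by rw [hpy, hyq]
  have hql : ∀ x, q * (q * x * p) = q * x * p := fun x => by simp only [← mul_assoc, hq]
  have hpr : ∀ x, q * x * p * p = q * x * p := fun x => by rw [mul_assoc, hp]
  -- Semiprimeness is used for y and then for yzy. With u = qzp and v = qxp, the relation uyv =
  -- -(vyu) exposes a factor uyu = 0.
  refine hsp y fun z => hsp _ fun x => ?_
  have e1 := hyb (q * z * p) (hql z) (hpr z)
  have e2 := hlin (q * z * p) (q * x * p) (hql z) (hpr z) (hql x) (hpr x)
  rw [← hcorner z]
  calc y * (q * z * p) * y * x * (y * (q * z * p) * y)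
      = y * (q * z * p) * (y * x * y) * (q * z * p) * y := by simp only [mul_assoc]
    _ = y * (q * z * p * y * (q * x * p)) * y * (q * z * p) * y := by
      rw [← hcorner x]; simp only [mul_assoc]
    _ = -(y * (q * x * p) * y * ((q * z * p) * y * (q * z * p)) * y) := by
      rw [e2]; simp only [mul_assoc, mul_neg, neg_mul]
    _ = 0 := by rw [e1]; simp

theorem IsTwistedXiLieDerivable.map_mul_complement
    (hsp : ∀ y : R, (∀ x, y * x * y = 0) → y = 0) (hξ : ξ ≠ 1)
    (hD : IsTwistedXiLieDerivable ξ c D) (hD1 : D 1 = 0) {p q : R} (hp : p * p = p)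
    (hq : q * q = q) (hpq : p * q = 0) (hqp : q * p = 0) (h1 : p + q = 1) (X : R) :
    D (X * p) * q = X * p * D p := by
  have ha := hD.map_corner_mul hξ hD1 hp hq hpq hqp h1 (a := p * X * p)
    (by simp only [← mul_assoc, hp]) (by rw [mul_assoc, hp])
  have hql : q * (q * X * p) = q * X * p := by simp only [← mul_assoc, hq]
  have hpr : q * X * p * p = q * X * p := by rw [mul_assoc, hp]
  have hb := (hD.diagonal_of_offDiagonal hξ hD1 hp hq hpq hqp h1 hql hpr).1
  have hb0 := hD.offDiagonal_of_offDiagonal hsp hξ hp hq hpq hql hpr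
  have hb' : D (q * X * p) * q = q * X * p * D p := by
    rw [← hb]
    calc D (q * X * p) * q = (p + q) * (D (q * X * p) * q) := by rw [h1, one_mul]
      _ = _ := by rw [add_mul, hb0, zero_add]
  have hX : X * p = p * X * p + q * X * p := by rw [← add_mul, ← add_mul, h1, one_mul]
  rw [hX, map_add, add_mul, add_mul, ha, hb']

theorem IsTwistedXiLieDerivable.map_mul_idempotent
    (hsp : ∀ y : R, (∀ x, y * x * y = 0) → y = 0) (hξ : ξ ≠ 1)
    (hD : IsTwistedXiLieDerivable ξ c D) (hD1 : D 1 = 0) {p : R} (hp : p * p = p) (X : R) :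
    D (X * p) = D X * p + X * D p := by
  obtain ⟨q, h1⟩ : ∃ q, p + q = 1 := ⟨1 - p, by abel⟩
  obtain rfl : q = 1 - p := eq_sub_of_add_eq' h1
  have hq : (1 - p) * (1 - p) = 1 - p := by noncomm_ring [hp]
  have hpq : p * (1 - p) = 0 := by noncomm_ring [hp]
  have hqp : (1 - p) * p = 0 := by noncomm_ring [hp]
  have e1 := hD.map_mul_complement hsp hξ hD1 hp hq hpq hqp h1 X
  -- Exchanging p and 1 - p gives D(X(1 - p))p, the difference between D(X)p and D(Xp)p.
  have e2 := hD.map_mul_complement hsp hξ hD1 hq hp hqp hpq (by rw [add_comm, h1]) X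
  have h2 : D X = D (X * p) + D (X * (1 - p)) := by rw [← map_add, ← mul_add, h1, mul_one]
  rw [map_sub, hD1, zero_sub] at e2
  calc D (X * p) = D (X * p) * p + D (X * p) * (1 - p) := by noncomm_ring
    _ = D X * p + X * D p := by rw [e1, h2, add_mul, e2]; noncomm_ring

theorem IsXiLieDerivableAtZeroProducts.exists_derivation
    (hsp : ∀ y : R, (∀ x, y * x * y = 0) → y = 0) (hf : FaithfulOffDiagonal R) (hξ : ξ ≠ 1)
    {L : R →+ R} (hL : IsXiLieDerivableAtZeroProducts ξ L) :
    L 1 ∈ Subring.center R ∧ ∃ φ : R →+ R, IsAdditiveDerivation φ ∧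
      φ (ξ • (1 : R)) = ξ • L 1 ∧ ∀ A, L A = φ A + L 1 * A := by
  have hc : L 1 ∈ Subring.center R :=
    mem_center_of_commute_idempotents hf fun p hp => commute_map_one_of_isIdempotentElem hL hp
  have hcc : ∀ A, A * L 1 = L 1 * A := Subring.mem_center_iff.mp hc
  let φ : R →+ R := L - AddMonoidHom.mulLeft (L 1)
  have hφ : ∀ A, φ A = L A - L 1 * A := fun A => rfl
  have hLφ : ∀ A, L A = φ A + L 1 * A := fun A => by rw [hφ, sub_add_cancel]
  have hφ1 : φ 1 = 0 := by rw [hφ, mul_one, sub_self]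
  have hT : IsTwistedXiLieDerivable ξ (L 1) φ := by
    intro A B hAB
    have h := hL A B hAB
    have hAcB : A * (L 1 * B) = 0 := by rw [← mul_assoc, hcc, mul_assoc, hAB, mul_zero]
    have hBcA : B * (L 1 * A) = L 1 * (B * A) := by rw [← mul_assoc, hcc, mul_assoc]
    simp only [xiLie, hAB, zero_sub, map_neg] at h
    rw [hLφ A, hLφ B, hLφ (ξ • (B * A))] at h
    simp only [add_mul, mul_add, mul_assoc, hAB, hAcB, hBcA,
      mul_smul_comm, mul_zero, smul_add] at h
    linear_combination (norm := module) -h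
  have hder : IsAdditiveDerivation φ :=
    isAdditiveDerivation_of_map_mul_idempotent hf hφ1 fun p X hp =>
      hT.map_mul_idempotent hsp hξ hφ1 hp X
  refine ⟨hc, φ, hder, ?_, hLφ⟩
  have hξ1 : ξ • (1 : R) ∈ Subring.center R := by
    rw [Subring.mem_center_iff]; intro A; simp
  have hd := hder.map_mem_center hξ1
  have hdc := Subring.mem_center_iff.mp hd
  -- This is the discrepancy between the Leibniz rule and the twisted identity for φ(ξBA).
  have hB : ∀ A B, A * B = 0 → (φ (ξ • (1 : R)) - ξ • L 1) * (B * A) = 0 := by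
    intro A B hAB
    have h := hT A B hAB
    have h1 : ξ • (B * A) = (ξ • (1 : R)) * (B * A) := by simp
    have h2 := hder A B
    rw [hAB, map_zero] at h2
    have h3 : φ A * B = - (A * φ B) := by rw [eq_neg_iff_add_eq_zero, ← h2]
    rw [h1, hder, hder, h3] at h
    simp only [smul_mul_assoc, one_mul, smul_add] at h
    rw [sub_mul, smul_mul_assoc]
    linear_combination (norm := module) h
  rw [← sub_eq_zero]
  refine hf _ fun p X Y hp => ?_
  -- With this choice BA is the off-diagonal element pX(1 - p).
  have h := hB (X * (1 - p)) p (by rw [mul_assoc, sub_mul, hp, one_mul, sub_self, mul_zero])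
  have hcomm : (φ (ξ • (1 : R)) - ξ • L 1) * Y = Y * (φ (ξ • (1 : R)) - ξ • L 1) := by
    rw [sub_mul, mul_sub, hdc, smul_mul_assoc, mul_smul_comm, hcc]
  rw [← mul_assoc, hcomm, mul_assoc, mul_assoc p, h, mul_zero]

theorem IsAdditiveDerivation.isXiLieDerivableAtZeroProducts {L φ : R →+ R}
    (hc : L 1 ∈ Subring.center R) (hφ : IsAdditiveDerivation φ)
    (hφξ : φ (ξ • (1 : R)) = ξ • L 1) (hL : ∀ A, L A = φ A + L 1 * A) :
    IsXiLieDerivableAtZeroProducts ξ L := by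
  intro A B hAB
  have hcc : ∀ A, A * L 1 = L 1 * A := Subring.mem_center_iff.mp hc
  have h1 : ξ • (B * A) = (ξ • (1 : R)) * (B * A) := by simp
  have h2 := hφ A B
  rw [hAB, map_zero] at h2
  have hAcB : A * (L 1 * B) = 0 := by rw [← mul_assoc, hcc, mul_assoc, hAB, mul_zero]
  have hBcA : B * (L 1 * A) = L 1 * (B * A) := by rw [← mul_assoc, hcc, mul_assoc]
  have h3 : φ (ξ • (B * A)) = ξ • (L 1 * (B * A)) + ξ • (φ B * A + B * φ A) := by
    rw [h1, hφ, hφ, hφξ]; simp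
  have h4 : φ A * B = - (A * φ B) := by rw [eq_neg_iff_add_eq_zero, ← h2]
  simp only [xiLie, hAB, zero_sub, map_neg, hL (ξ • (B * A)), h3]
  rw [hL A, hL B]
  simp only [add_mul, mul_add, mul_assoc, hAB, hAcB, hBcA, h4, mul_zero, mul_smul_comm, smul_add]
  module

theorem IsAdditiveDerivation.isXiLieDerivableAtZeroProducts_zero {L φ : R →+ R}
    (hc : L 1 ∈ Subring.center R) (hφ : IsAdditiveDerivation φ)
    (hL : ∀ A, L A = φ A + L 1 * A) : IsXiLieDerivableAtZeroProducts (0 : ℂ) L :=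
  hφ.isXiLieDerivableAtZeroProducts hc (by simp) hL

/-- Linearizing the square yields the rule for AB + BA, which is the ξ-Lie product at ξ = -1. -/
theorem IsAdditiveJordanDerivation.isXiLieDerivableAtZeroProducts {L : R →+ R}
    (hL : IsAdditiveJordanDerivation L) : IsXiLieDerivableAtZeroProducts (-1 : ℂ) L := by
  intro A B _
  have h := hL (A + B)
  have hA := hL A
  have hB := hL B
  have e : (A + B) ^ 2 = A ^ 2 + B ^ 2 + (A * B + B * A) := by noncomm_ring
  rw [e, map_add, map_add, hA, hB, map_add] at h
  simp only [xiLie, neg_smul, one_smul, sub_neg_eq_add]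
  rw [eq_comm, ← sub_eq_zero] at h
  rw [eq_comm, ← sub_eq_zero, ← h]
  noncomm_ring [map_add]

/-- Additivity gives ℚ-linearity, and i² = -1 gives 2iD(iI) = 0. -/
theorem IsAdditiveDerivation.map_rational_smul_one (hD : IsAdditiveDerivation D)
    (hξ : IsRationalComplex ξ) : D (ξ • (1 : R)) = 0 := by
  obtain ⟨⟨a, ha⟩, b, hb⟩ := hξ
  have hrat : ∀ (r : ℚ) (x : R), D ((r : ℂ) • x) = (r : ℂ) • D x := fun r x =>
    map_ratCast_smul D ℂ ℂ r x
  have hI : D (Complex.I • (1 : R)) = 0 := by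
    have h := hD (Complex.I • 1) (Complex.I • 1)
    have e : (Complex.I • (1 : R)) * (Complex.I • 1) = -1 := by
      rw [smul_mul_smul_comm, Complex.I_mul_I]; simp
    rw [e, map_neg, hD.map_one, mul_smul_comm, smul_mul_assoc, mul_one, one_mul, ← two_smul ℂ,
      smul_smul, neg_zero] at h
    exact (smul_eq_zero.mp h.symm).resolve_left (by simp)
  have e : ξ = (a : ℂ) + (b : ℂ) * Complex.I := by
    rw [← Complex.re_add_im ξ, ha, hb]; simp
  rw [e, add_smul, mul_smul, map_add, hrat, hrat, hI, hD.map_one, smul_zero, smul_zero, add_zero]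

end DerivationFromIdempotents

/-! ### Commuting with the projections of M implies commuting with M. -/

section SpectralProjections

open ContinuousLinearMap VonNeumannAlgebra

variable {H : Type*} [NormedAddCommGroup H] [InnerProductSpace ℂ H] [CompleteSpace H]

theorem VonNeumannAlgebra.mem_of_commute_commutant (M : VonNeumannAlgebra H) {T : H →L[ℂ] H}
    (h : ∀ S ∈ M.commutant, Commute S T) : T ∈ M := by
  rw [← M.commutant_commutant, mem_commutant_iff]
  exact h

theorem VonNeumannAlgebra.exists_eq_sub_of_isSelfAdjoint (M : VonNeumannAlgebra H)
    {T : H →L[ℂ] H} (hT : T ∈ M) (hTs : IsSelfAdjoint T) :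
    ∃ P ∈ M, ∃ N ∈ M, 0 ≤ P ∧ 0 ≤ N ∧ P * N = 0 ∧ T = P - N := by
  have hmem : ∀ f : ℝ → ℝ, cfcₙ f T ∈ M := fun f => M.mem_of_commute_commutant fun S hS => by
    have h : Commute T S := mem_commutant_iff.mp hS T hT
    exact (hTs.commute_cfcₙ h f).symm
  exact ⟨T⁺, hmem _, T⁻, hmem _, CFC.posPart_nonneg T, CFC.negPart_nonneg T,
    CFC.posPart_mul_negPart T, (CFC.posPart_sub_negPart T hTs).symm⟩

/-- The projection onto the kernel of an element of a von Neumann algebra. -/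
theorem VonNeumannAlgebra.starProjection_ker_mem (M : VonNeumannAlgebra H) {T : H →L[ℂ] H}
    (hT : T ∈ M) [T.ker.HasOrthogonalProjection] : T.ker.starProjection ∈ M := by
  rw [IsStarProjection.mem_iff isStarProjection_starProjection]
  intro S hS
  rw [Submodule.range_starProjection, Module.End.mem_invtSubmodule]
  intro x hx
  have h : T * S = S * T := mem_commutant_iff.mp hS T hT
  have h' := congrArg (fun F : H →L[ℂ] H => F x) h
  have hx' : T x = 0 := hx
  change T (S x) = 0
  simpa [hx'] using h'

/-- Bisection of a positive element by a spectral projection. -/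
theorem VonNeumannAlgebra.exists_isStarProjection_sub_smul (M : VonNeumannAlgebra H)
    {Y : H →L[ℂ] H} (hY : Y ∈ M) {r : ℝ} (hY0 : 0 ≤ Y) (hYr : Y ≤ algebraMap ℝ _ (2 * r)) :
    ∃ p ∈ M, IsStarProjection p ∧ 0 ≤ Y - (r : ℂ) • p ∧ Y - (r : ℂ) • p ≤ algebraMap ℝ _ r := by
  have hYs : IsSelfAdjoint Y := .of_nonneg hY0
  set T : H →L[ℂ] H := Y - (r : ℂ) • 1 with hT
  have hrr : (algebraMap ℝ (H →L[ℂ] H) r) = (r : ℂ) • 1 := by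
    ext x; simp [Algebra.algebraMap_eq_smul_one]
  have hrr2 : (algebraMap ℝ (H →L[ℂ] H) (2 * r)) = (r : ℂ) • 1 + (r : ℂ) • 1 := by
    rw [two_mul, map_add, hrr]
  rw [hrr2] at hYr
  rw [hrr]
  have hrs : IsSelfAdjoint ((r : ℂ) • (1 : H →L[ℂ] H)) := by
    rw [← hrr]; exact IsSelfAdjoint.algebraMap _ (IsSelfAdjoint.all r)
  have hTs : IsSelfAdjoint T := hYs.sub hrs
  have hTM : T ∈ M := sub_mem hY (SMulMemClass.smul_mem _ (one_mem M))
  obtain ⟨P, hPM, N, -, hP0, hN0, hPN, hdec⟩ := M.exists_eq_sub_of_isSelfAdjoint hTM hTs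
  have hY' : Y = P - N + (r : ℂ) • 1 := by rw [← hdec, hT, sub_add_cancel]
  clear_value T
  have : CompleteSpace P.ker := P.isClosed_ker.completeSpace_coe
  -- Here e projects onto ker P, which contains the range of N because PN = 0.
  obtain ⟨e, heM, hes, hPe, heN⟩ :
      ∃ e ∈ M, IsStarProjection e ∧ P * e = 0 ∧ e * N = N := by
    refine ⟨P.ker.starProjection, M.starProjection_ker_mem hPM, isStarProjection_starProjection,
      ?_, ?_⟩
    · ext x
      exact P.ker.starProjection_apply_mem x
    · ext x
      refine Submodule.starProjection_eq_self_iff.mpr ?_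
      exact congrArg (fun F : H →L[ℂ] H => F x) hPN
  have heP : e * P = 0 := by
    have h := congrArg star hPe
    rwa [star_mul, hes.isSelfAdjoint.star_eq, (IsSelfAdjoint.of_nonneg hP0).star_eq,
      star_zero] at h
  have hNe : N * e = N := by
    have h := congrArg star heN
    rwa [star_mul, hes.isSelfAdjoint.star_eq, (IsSelfAdjoint.of_nonneg hN0).star_eq] at h
  have hee : e * e = e := hes.isIdempotentElem
  have hfs : IsSelfAdjoint (1 - e) := hes.one_sub.isSelfAdjoint
  -- Compressing 0 ≤ Y by e bounds N by re; compressing Y ≤ 2r by 1 - e bounds P by r(1 - e).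
  have h1 : 0 ≤ (r : ℂ) • e - N := by
    have h := hes.isSelfAdjoint.conjugate_nonneg hY0
    have h' : e * Y * e = (r : ℂ) • e - N := by
      simp only [hY', mul_add, add_mul, mul_sub, heP, heN, hNe, hee,
        mul_smul_comm, smul_mul_assoc, mul_one, zero_sub, neg_mul]
      abel
    rwa [h'] at h
  have h2 : 0 ≤ (r : ℂ) • (1 - e) - P := by
    have h := hfs.conjugate_nonneg (sub_nonneg.mpr hYr)
    have h' : (1 - e) * ((r : ℂ) • 1 + (r : ℂ) • 1 - Y) * (1 - e) = (r : ℂ) • (1 - e) - P := by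
      simp only [hY', mul_add, add_mul, mul_sub, sub_mul, heP, heN, hNe, hPe, hee, zero_mul,
        mul_smul_comm, smul_mul_assoc, mul_one, one_mul, smul_sub]
      abel
    rwa [h'] at h
  refine ⟨1 - e, sub_mem (one_mem M) heM, hes.one_sub, ?_, ?_⟩
  · have h' : Y - (r : ℂ) • (1 - e) = P + ((r : ℂ) • e - N) := by
      rw [hY', smul_sub]; abel
    rw [h']
    exact add_nonneg hP0 h1
  · rw [← sub_nonneg]
    have h' : (r : ℂ) • 1 - (Y - (r : ℂ) • (1 - e)) = N + ((r : ℂ) • (1 - e) - P) := by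
      rw [hY', smul_sub]; abel
    rw [h']
    exact add_nonneg hN0 h2

/-- Subtracting (r/2)p from Y leaves the commutator with X unchanged and halves the bound on Y. -/
theorem VonNeumannAlgebra.norm_commutator_le_of_commute_projections (M : VonNeumannAlgebra H)
    {X : H →L[ℂ] H} (hX : ∀ p ∈ M, IsStarProjection p → Commute X p) (n : ℕ) :
    ∀ (r : ℝ) (Y : H →L[ℂ] H), Y ∈ M → 0 ≤ r → 0 ≤ Y → Y ≤ algebraMap ℝ _ r →
      ‖X * Y - Y * X‖ ≤ 2 * ‖X‖ * r / 2 ^ n := by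
  induction n with
  | zero =>
    intro r Y _ hr hY0 hYr
    have hn : ‖Y‖ ≤ r := (CStarAlgebra.norm_le_iff_le_algebraMap Y hr hY0).mpr hYr
    calc ‖X * Y - Y * X‖ ≤ ‖X * Y‖ + ‖Y * X‖ := norm_sub_le _ _
      _ ≤ ‖X‖ * ‖Y‖ + ‖Y‖ * ‖X‖ := add_le_add (norm_mul_le _ _) (norm_mul_le _ _)
      _ = 2 * ‖X‖ * ‖Y‖ := by ring
      _ ≤ 2 * ‖X‖ * r / 2 ^ 0 := by rw [pow_zero, div_one]; gcongr
  | succ n ih =>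
    intro r Y hY hr hY0 hYr
    obtain ⟨p, hp, hps, h0, h1⟩ := M.exists_isStarProjection_sub_smul hY (r := r / 2) hY0
      (by rwa [mul_div_cancel₀ r two_ne_zero])
    have h := ih (r / 2) _ (sub_mem hY (SMulMemClass.smul_mem _ hp)) (by positivity) h0 h1
    have hc : X * p = p * X := hX p hp hps
    rw [mul_sub, sub_mul, mul_smul_comm, smul_mul_assoc, hc, sub_sub_sub_cancel_right] at h
    calc _ ≤ _ := h
      _ = _ := by rw [pow_succ]; field_simp

theorem VonNeumannAlgebra.commute_of_commute_projections (M : VonNeumannAlgebra H)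
    {X : H →L[ℂ] H} (hX : ∀ p ∈ M, IsStarProjection p → Commute X p) {Y : H →L[ℂ] H}
    (hY : Y ∈ M) : Commute X Y := by
  have hpos : ∀ Z ∈ M, 0 ≤ Z → Commute X Z := by
    intro Z hZ hZ0
    have hZn : Z ≤ algebraMap ℝ _ ‖Z‖ :=
      (IsSelfAdjoint.of_nonneg hZ0).le_algebraMap_norm_self
    have hlim : Filter.Tendsto (fun n : ℕ => 2 * ‖X‖ * ‖Z‖ / 2 ^ n) Filter.atTop (nhds 0) :=
      Filter.Tendsto.const_div_atTop (tendsto_pow_atTop_atTop_of_one_lt one_lt_two) _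
    have h := ge_of_tendsto' hlim fun n =>
      M.norm_commutator_le_of_commute_projections hX n _ Z hZ (norm_nonneg Z) hZ0 hZn
    exact sub_eq_zero.mp (norm_le_zero_iff.mp h)
  have hsa : ∀ Z ∈ M, IsSelfAdjoint Z → Commute X Z := by
    intro Z hZ hZs
    obtain ⟨P, hP, N, hN, hP0, hN0, -, rfl⟩ := M.exists_eq_sub_of_isSelfAdjoint hZ hZs
    exact (hpos P hP hP0).sub_right (hpos N hN hN0)
  have hs : star Y ∈ M := star_mem hY
  have h1 := hsa (Y + star Y) (add_mem hY hs) (IsSelfAdjoint.add_star_self Y)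
  have h2 := hsa (Complex.I • (Y - star Y)) (SMulMemClass.smul_mem _ (sub_mem hY hs)) (by
    rw [IsSelfAdjoint, star_smul, star_sub, star_star]; simp [← smul_neg])
  have e : Y = (2⁻¹ : ℂ) • ((Y + star Y) - Complex.I • (Complex.I • (Y - star Y))) := by
    rw [smul_smul, Complex.I_mul_I]; module
  rw [e]
  exact (h1.sub_right (h2.smul_right _)).smul_right _

end SpectralProjections

/-! ### Faithfulness of the off-diagonal ideal. -/

section Faithfulness

open ContinuousLinearMap VonNeumannAlgebra

variable {H : Type*} [NormedAddCommGroup H] [InnerProductSpace ℂ H] [CompleteSpace H]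
  (M : VonNeumannAlgebra H)

/-- Take x = y* and apply the C*-identity twice. -/
theorem VonNeumannAlgebra.eq_zero_of_forall_mul_mul_eq_zero (y : M)
    (h : ∀ x, y * x * y = 0) : y = 0 := by
  have h1 := congrArg (fun t : M => (t : H →L[ℂ] H)) (h (star y))
  have h2 : (y : H →L[ℂ] H) * star (y : H →L[ℂ] H) * y = 0 := h1
  have h3 : star (star (y : H →L[ℂ] H) * y) * (star (y : H →L[ℂ] H) * y) = 0 := by
    rw [star_mul, star_star, mul_assoc, ← mul_assoc (y : H →L[ℂ] H), h2, mul_zero]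
  exact Subtype.ext (CStarRing.star_mul_self_eq_zero_iff _ |>.mp
    (CStarRing.star_mul_self_eq_zero_iff _ |>.mp h3))

/-- The common kernel of the operators `(1 - p) X p Y` for `p` a projection. -/
def offDiagonalKer : Submodule ℂ H :=
  ⨅ (p : M) (_ : IsStarProjection p) (X : M) (Y : M),
    (((1 - p) * X * p * Y : M) : H →L[ℂ] H).ker

variable {M}

theorem mem_offDiagonalKer {x : H} : x ∈ offDiagonalKer M ↔ ∀ p : M, IsStarProjection p →
    ∀ X Y : M, (((1 - p) * X * p * Y : M) : H →L[ℂ] H) x = 0 := by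
  simp only [offDiagonalKer, Submodule.mem_iInf]
  rfl

theorem isClosed_offDiagonalKer : IsClosed (offDiagonalKer M : Set H) := by
  simp only [offDiagonalKer, Submodule.coe_iInf]
  exact isClosed_iInter fun p => isClosed_iInter fun _ => isClosed_iInter fun X =>
    isClosed_iInter fun Y => ContinuousLinearMap.isClosed_ker _

theorem apply_mem_offDiagonalKer_of_mem {x : H} (hx : x ∈ offDiagonalKer M) (Z : M) :
    (Z : H →L[ℂ] H) x ∈ offDiagonalKer M := by
  rw [mem_offDiagonalKer] at hx ⊢
  intro p hp X Y
  have h := hx p hp X (Y * Z)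
  rwa [← mul_assoc] at h

theorem apply_mem_offDiagonalKer_of_mem_commutant {x : H} (hx : x ∈ offDiagonalKer M)
    {S : H →L[ℂ] H} (hS : S ∈ M.commutant) : S x ∈ offDiagonalKer M := by
  rw [mem_offDiagonalKer] at hx ⊢
  intro p hp X Y
  have h := mem_commutant_iff.mp hS _ ((1 - p) * X * p * Y : M).2
  have h' := congrArg (fun F : H →L[ℂ] H => F x) h
  exact h'.trans ((congrArg S (hx p hp X Y)).trans (map_zero S))

/-- The kernel is invariant under M and its commutant, so its projection C is central. Since (1 -
p)XpC = 0 for X and for X*, XC commutes with all projections, hence with M. Thus C is abelian, and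
so zero. -/
theorem offDiagonalKer_eq_bot (hM : NoCentralSummandOfTypeIOne M) : offDiagonalKer M = ⊥ := by
  have : CompleteSpace (offDiagonalKer M) := isClosed_offDiagonalKer.completeSpace_coe
  set e := (offDiagonalKer M).starProjection with he
  have hes : IsStarProjection e := isStarProjection_starProjection
  have heM : e ∈ M := (IsStarProjection.mem_iff hes M).mpr fun S hS => by
    rw [Submodule.range_starProjection]
    exact fun x hx => apply_mem_offDiagonalKer_of_mem_commutant hx hS
  have heM' : e ∈ M.commutant := (IsStarProjection.mem_iff hes M.commutant).mpr fun S hS => by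
    rw [Submodule.range_starProjection]
    rw [commutant_commutant] at hS
    exact fun x hx => apply_mem_offDiagonalKer_of_mem hx ⟨S, hS⟩
  have hecomm := mem_commutant_iff.mp heM'
  let C : M := ⟨e, heM⟩
  have hCs : IsStarProjection C :=
    ⟨Subtype.ext hes.isIdempotentElem, Subtype.ext hes.isSelfAdjoint⟩
  have hCc : ∀ A : M, A * C = C * A := fun A => Subtype.ext (hecomm A A.2)
  have hoff : ∀ p : M, IsStarProjection p → ∀ X : M, (1 - p) * X * p * C = 0 := by
    intro p hp X
    have : (1 - p) * X * p * C = (1 - p) * X * p * 1 * C := by rw [mul_one]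
    rw [this]
    refine Subtype.ext (ContinuousLinearMap.ext fun x => ?_)
    exact mem_offDiagonalKer.mp ((offDiagonalKer M).starProjection_apply_mem x) p hp X 1
  have hpX : ∀ p : M, IsStarProjection p → ∀ X : M, X * C * p = p * (X * C) := by
    intro p hp X
    have e1 := hoff p hp X
    have e2 := congrArg star (hoff p hp (star X))
    simp only [star_mul, star_sub, star_one, star_star, star_zero, hp.isSelfAdjoint.star_eq,
      hCs.isSelfAdjoint.star_eq] at e2
    rw [sub_mul, sub_mul, sub_mul, one_mul, sub_eq_zero] at e1
    rw [← mul_assoc p, ← mul_assoc, mul_sub, mul_one, sub_eq_zero, ← hCc] at e2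
    calc X * C * p = X * p * C := by rw [mul_assoc, ← hCc, mul_assoc]
      _ = p * X * C * p := by rw [e1, mul_assoc _ p, hCc p, mul_assoc (p * X)]
      _ = p * (X * C) := by rw [← e2, mul_assoc]
  have hcomm : ∀ X Y : M, Commute (X * C) Y := by
    intro X Y
    have h := M.commute_of_commute_projections (X := (X * C : M)) (fun p hp hps => by
      have h := hpX ⟨p, hp⟩ ⟨Subtype.ext hps.isIdempotentElem, Subtype.ext hps.isSelfAdjoint⟩ X
      exact congrArg Subtype.val h) Y.2
    exact Subtype.ext h
  have hC0 : C = 0 := by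
    refine hM C (Subring.mem_center_iff.mpr hCc) ⟨hCs, fun A B => ?_⟩
    exact hcomm _ _
  rw [eq_bot_iff]
  intro x hx
  have h1 : e x = x := Submodule.starProjection_eq_self_iff.mpr hx
  have h2 : e = 0 := congrArg Subtype.val hC0
  rw [Submodule.mem_bot, ← h1, h2]
  rfl

/-- Taking adjoints places the range of A* in `offDiagonalKer M`. -/
theorem NoCentralSummandOfTypeIOne.faithfulOffDiagonal (hM : NoCentralSummandOfTypeIOne M) :
    FaithfulOffDiagonal M := by
  intro A hA
  rw [← star_eq_zero]
  refine Subtype.ext (ContinuousLinearMap.ext fun x => ?_)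
  have hx : ((star A : M) : H →L[ℂ] H) x ∈ offDiagonalKer M := by
    rw [mem_offDiagonalKer]
    intro p hp X Y
    have h := congrArg star (hA p (star X) (star Y) hp.isIdempotentElem)
    simp only [star_mul, star_sub, star_one, star_star, star_zero, hp.isSelfAdjoint.star_eq] at h
    have h' : (1 - p) * X * p * Y * star A = 0 := by rw [← h]; simp only [mul_assoc]
    exact congrArg (fun F : M => (F : H →L[ℂ] H) x) h'
  rw [offDiagonalKer_eq_bot hM, Submodule.mem_bot] at hx
  exact hx

end Faithfulness

/-! ### The main theorem. -/

theorem theorem3p1 {H : Type*} [NormedAddCommGroup H] [InnerProductSpace ℂ H] [CompleteSpace H]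
    (M : VonNeumannAlgebra H) (hM : NoCentralSummandOfTypeIOne M)
    (ξ : ℂ) (hξ : ξ ≠ 1) (L : M →+ M) :
    (IsXiLieDerivableAtZeroProducts ξ L ↔
      L 1 ∈ Subring.center M ∧
        ((ξ ≠ 0 ∧ ξ ≠ -1 ∧
            ∃ φ : M →+ M, IsAdditiveDerivation φ ∧ φ (ξ • (1 : M)) = ξ • L 1 ∧
              ∀ A : M, L A = φ A + L 1 * A) ∨
          (ξ = 0 ∧
            ∃ φ : M →+ M, IsAdditiveDerivation φ ∧ ∀ A : M, L A = φ A + L 1 * A) ∨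
          (ξ = -1 ∧ IsAdditiveJordanDerivation L))) ∧
    (IsXiLieDerivableAtZeroProducts ξ L → ξ ≠ 0 → ξ ≠ -1 → IsRationalComplex ξ →
      IsAdditiveDerivation L) := by
  have hsp := M.eq_zero_of_forall_mul_mul_eq_zero
  have hf := hM.faithfulOffDiagonal
  have heq : ∀ φ : M →+ M, L 1 = 0 → (∀ A, L A = φ A + L 1 * A) → φ = L := fun φ h0 h => by
    ext1 A
    rw [h A, h0, zero_mul, add_zero]
  refine ⟨⟨fun hL => ?_, ?_⟩, fun hL h0 _ hrat => ?_⟩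
  · obtain ⟨hc, φ, hφ, hφξ, hLφ⟩ := hL.exists_derivation hsp hf hξ
    refine ⟨hc, ?_⟩
    by_cases h0 : ξ = 0
    · exact Or.inr (Or.inl ⟨h0, φ, hφ, hLφ⟩)
    by_cases h1 : ξ = -1
    · refine Or.inr (Or.inr ⟨h1, ?_⟩)
      -- Since φ(-I) = 0, the relation φ(ξI) = ξL(I) forces L(I) = 0, so L = φ.
      rw [h1, neg_smul, one_smul, map_neg, hφ.map_one, neg_smul, one_smul, neg_zero] at hφξ
      rw [← heq φ (neg_eq_zero.mp hφξ.symm) hLφ]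
      intro A
      rw [pow_two, hφ]
    · exact Or.inl ⟨h0, h1, φ, hφ, hφξ, hLφ⟩
  · rintro ⟨hc, ⟨-, -, φ, hφ, hφξ, hL⟩ | ⟨rfl, φ, hφ, hL⟩ | ⟨rfl, hL⟩⟩
    · exact hφ.isXiLieDerivableAtZeroProducts hc hφξ hL
    · exact hφ.isXiLieDerivableAtZeroProducts_zero hc hL
    · exact hL.isXiLieDerivableAtZeroProducts
  · obtain ⟨_, φ, hφ, hφξ, hLφ⟩ := hL.exists_derivation hsp hf hξ
    rw [hφ.map_rational_smul_one hrat] at hφξ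
    rw [← heq φ ((smul_eq_zero.mp hφξ.symm).resolve_left h0) hLφ]
    exact hφ
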